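/- All digraphs are finite and have no loops and no multiple arcs (a pair of opposite arcs is allowed). For a strongly connected digraph $G$ with vertices $v_1,\dots,v_n$, let $d_{ij}$ be the length of a shortest directed path from $v_i$ to $v_j$, let $D(G)=(d_{ij})$, and let $\mathrm{Tr}(v_i)=\sum_j d_{ij}$. For $0\le\alpha<1$ put $D_\alpha(G)=\alpha\,\mathrm{diag}(\mathrm{Tr}(v_1),\dots,\mathrm{Tr}(v_n))+(1-\alpha)D(G)$, and let $\mu_\alpha(G)$ be the largest modulus of an eigenvalue of $D_\alpha(G)$. The dichromatic number of $G$ is the least $k$ such that $V(G)$ can be partitioned into $k$ sets each inducing a subdigraph without directed cycles (a pair of opposite arcs is a directed cycle). Let $n\ge k\ge 2$. Let $\mathcal C_n^k$ be the set of strongly connected digraphs of order $n$ with dichromatic number $k$. Let $\mathcal T_n^k$ be the set of digraphs of order $n$ whose vertex set is partitioned into $k$ nonempty sets $V^1,\dots,V^k$ such that each $V^i$ induces a transitive tournament (a tournament whose set of outdegrees is $\{0,1,\dots,|V^i|-1\}$) and, for $i\ne j$, all arcs in both directions between $V^i$ and $V^j$ are present. **Theorem.** Up to isomorphism there is exactly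 one digraph $\mathcal T_n^{k*}$ in $\mathcal T_n^k$ with $\bigl||V^i|-|V^j|\bigr|\le 1$ for all $i,j$, and it belongs to $\mathcal C_n^k$. For every $\alpha$ with $0\le\alpha<1$: 1. for every $G\in\mathcal T_n^k$, $\mu_\alpha(G)\ge\mu_\alpha(\mathcal T_n^{k*})$, with equality if and only if $G\cong\mathcal T_n^{k*}$; 2. for every $G\in\mathcal C_n^k$, $\mu_\alpha(G)\ge\mu_\alpha(\mathcal T_n^{k*})$, with equality if and only if $G\cong\mathcal T_n^{k*}$. Thus $\mathcal T_n^{k*}$ is the unique digraph with minimum $D_\alpha$ spectral radius in $\mathcal C_n^k$, for each $0\le\alpha<1$. -/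

import Mathlib

/-! Digraphs are Mathlib's `Digraph V` (one relation on `V`, so there are no multiple arcs; opposite
arcs `u → v`, `v → u` may both be present). -/

namespace Digraph

variable {V : Type*}

/-- No loops. -/
def IsSimple (G : Digraph V) : Prop := ∀ v, ¬ G.Adj v v

/-- The subdigraph `G[S]` induced by `S`. -/
def induce (G : Digraph V) (S : Set V) : Digraph S where
  Adj u v := G.Adj u v

/-- There is a directed walk of length `m` from `u` to `v`. -/
inductive HasWalk (G : Digraph V) : V → V → ℕ → Prop
  | nil (v : V) : HasWalk G v v 0
  | cons {u v w : V} {m : ℕ} (h : G.Adj u v) (p : HasWalk G v w m) : HasWalk G u w (m + 1)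

/-- Every vertex can be reached from every vertex along arcs. -/
def IsStronglyConnected (G : Digraph V) : Prop := ∀ u v, ∃ m, G.HasWalk u v m

/-- No directed cycle: no vertex lies on a closed directed walk of positive length. (A `2`-cycle
`u → v → u` is a directed cycle.) -/
def IsAcyclic (G : Digraph V) : Prop := ∀ v m, ¬ G.HasWalk v v (m + 1)

/-- A `k`-colouring: every colour class induces an acyclic subdigraph. -/
def IsAcyclicColoring (G : Digraph V) {k : ℕ} (c : V → Fin k) : Prop :=
  ∀ i, (G.induce (c ⁻¹' {i})).IsAcyclic

/-- The least number of acyclic sets into which the vertex set can be partitioned. (Allowing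
empty colour classes does not change the minimum.) -/
noncomputable def dichromaticNumber (G : Digraph V) : ℕ :=
  sInf {k | ∃ c : V → Fin k, G.IsAcyclicColoring c}

/-- The length of a shortest directed path (equivalently, walk) from `u` to `v`. Only used
for strongly connected digraphs, where one exists. -/
noncomputable def dist (G : Digraph V) (u v : V) : ℕ := sInf {m | G.HasWalk u v m}

/-- The transmission of a vertex: the sum of the distances from it to all vertices. -/
noncomputable def transmission [Fintype V] (G : Digraph V) (u : V) : ℕ := ∑ v, G.dist u v

/-- The distance matrix. -/
noncomputable def distMatrix (G : Digraph V) : Matrix V V ℝ :=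
  Matrix.of fun u v => (G.dist u v : ℝ)

/-- `D_α(G) = α Diag(Tr) + (1 - α) D(G)`. -/
noncomputable def alphaDistMatrix [Fintype V] [DecidableEq V] (α : ℝ) (G : Digraph V) :
    Matrix V V ℝ :=
  α • Matrix.diagonal (fun u => (G.transmission u : ℝ)) + (1 - α) • G.distMatrix

/-- The `D_α` spectral radius: the largest modulus of a complex eigenvalue of `D_α(G)`. -/
noncomputable def alphaSpectralRadius [Fintype V] [DecidableEq V] (α : ℝ) (G : Digraph V) :
    ENNReal :=
  spectralRadius ℂ ((G.alphaDistMatrix α).map Complex.ofReal)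

/-- Isomorphism of digraphs. -/
def Isomorphic {W : Type*} (G : Digraph V) (H : Digraph W) : Prop := Nonempty (G.Adj ≃r H.Adj)

/-- The outdegree of a vertex. -/
noncomputable def outdegree (G : Digraph V) (v : V) : ℕ := {w | G.Adj v w}.ncard

/-- Exactly one arc between any two distinct vertices, and no loops. -/
def IsTournament (G : Digraph V) : Prop :=
  G.IsSimple ∧ ∀ u v, u ≠ v → Xor (G.Adj u v) (G.Adj v u)

/-- A tournament on `m` vertices whose set of outdegrees is `{0, 1, …, m - 1}`. -/
def IsTransitiveTournament (G : Digraph V) : Prop :=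
  G.IsTournament ∧ Set.range G.outdegree = Set.Iio (Nat.card V)

/-- The (nonempty) classes of `c` are transitive tournaments, and all arcs, in both directions,
are present between distinct classes. -/
def IsTournamentJoin (G : Digraph V) {k : ℕ} (c : V → Fin k) : Prop :=
  Function.Surjective c ∧ (∀ i, (G.induce (c ⁻¹' {i})).IsTransitiveTournament) ∧
    ∀ u v, c u ≠ c v → G.Adj u v ∧ G.Adj v u

/-- Strongly connected simple digraphs of order `n` with dichromatic number `k`
(the class `𝒞ₙᵏ`). -/
def MemC [Fintype V] (n k : ℕ) (G : Digraph V) : Prop :=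
  Fintype.card V = n ∧ G.IsSimple ∧ G.IsStronglyConnected ∧ G.dichromaticNumber = k

/-- Joins of `k` transitive tournaments, of order `n` (the class `𝒯ₙᵏ`). -/
def MemT [Fintype V] (n k : ℕ) (G : Digraph V) : Prop :=
  Fintype.card V = n ∧ ∃ c : V → Fin k, G.IsTournamentJoin c

/-- Members of `𝒯ₙᵏ` whose part sizes differ pairwise by at most `1`. -/
def MemTStar [Fintype V] (n k : ℕ) (G : Digraph V) : Prop :=
  Fintype.card V = n ∧ ∃ c : V → Fin k, G.IsTournamentJoin c ∧
    ∀ i j, (c ⁻¹' {i}).ncard ≤ (c ⁻¹' {j}).ncard + 1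

end Digraph

/-! Reduction to joins. Colour a member of `𝒞ₙᵏ` with `k` acyclic classes and order each class
topologically: it becomes a spanning subdigraph of the `layeredJoin` of the class sizes
(`IsAcyclicColoring.exists_equiv`). Added arcs raise no distance, and a new arc lowers its own
distance from at least 2 to 1. By Perron–Frobenius the spectral radius drops strictly when an entry
of `D_α` does, so only joins matter (`MemC.isomorphic_or_lt`).

Balancing. In a join every distance between distinct vertices is 1, except 2 going backwards inside
a class. If `x` is the Perron vector, `r` its eigenvalue and `S` its sum, the eigenvalue equation at
position `p` of a class is `a p * x = (1 - α) * (S + sum of x over earlier positions)`, where `a p`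
does not depend on the class. Hence `x` is a function `g` of the position alone, and `g` is strictly
increasing. So `S = ∑ i, F (m i)`, where the partial sums `F` of `g` are discretely convex, and
balanced sizes of the same total give a strictly smaller sum. Transplanting `g` to the balanced join
changes only this sum, so its matrix maps `g` strictly below `r * g`; pairing with a positive left
eigenvector puts its spectral radius below `r` (`layeredJoin_alphaSpectralRadius_lt`). -/

namespace Matrix

/-! ### Perron–Frobenius theory for positive off-diagonal entries. -/

variable {V : Type*} [Fintype V] {A B : Matrix V V ℝ}

theorem mulVec_nonneg_of_nonneg (hA : ∀ i j, 0 ≤ A i j) {z : V → ℝ} (hz : ∀ i, 0 ≤ z i) (i : V) :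
    0 ≤ (A *ᵥ z) i :=
  Finset.sum_nonneg fun j _ => mul_nonneg (hA i j) (hz j)

theorem mulVec_add_self_pos (hA : ∀ i j, 0 ≤ A i j) (hpos : ∀ i j, i ≠ j → 0 < A i j)
    {z : V → ℝ} (hz : ∀ i, 0 ≤ z i) {j : V} (hj : 0 < z j) (i : V) : 0 < (A *ᵥ z) i + z i := by
  rcases eq_or_ne i j with rfl | hij
  · exact add_pos_of_nonneg_of_pos (mulVec_nonneg_of_nonneg hA hz i) hj
  · refine add_pos_of_pos_of_nonneg ?_ (hz i)
    exact (mul_pos (hpos i j hij) hj).trans_le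
      (Finset.single_le_sum (f := fun l => A i l * z l)
        (fun l _ => mul_nonneg (hA i l) (hz l)) (Finset.mem_univ j))

theorem exists_pos_mul_le [Nonempty V] {f z : V → ℝ} (hf : ∀ i, 0 < f i) (hz : ∀ i, 0 < z i) :
    ∃ ε > 0, ∀ i, ε * z i ≤ f i := by
  obtain ⟨i₀, h₀⟩ := Finite.exists_min fun i => f i / z i
  exact ⟨f i₀ / z i₀, div_pos (hf _) (hz _), fun i => (le_div_iff₀ (hz i)).1 (h₀ i)⟩

/-- The existence part of the Perron–Frobenius theorem, for a matrix whose off-diagonal entries are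
positive. -/
theorem exists_pos_eigenvector [Nonempty V] (hA : ∀ i j, 0 ≤ A i j)
    (hpos : ∀ i j, i ≠ j → 0 < A i j) :
    ∃ (r : ℝ) (x : V → ℝ), 0 ≤ r ∧ (∀ i, 0 < x i) ∧ A *ᵥ x = r • x := by
  classical
  let C : ℝ := ∑ i, ∑ j, A i j
  have bound : ∀ x ∈ stdSimplex ℝ V, ∀ c : ℝ, (∀ i, c * x i ≤ (A *ᵥ x) i) → c ≤ C := by
    intro x hx c hc
    calc c = ∑ i, c * x i := by rw [← Finset.mul_sum, hx.2, mul_one]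
      _ ≤ ∑ i, (A *ᵥ x) i := Finset.sum_le_sum fun i _ => hc i
      _ ≤ C := Finset.sum_le_sum fun i _ => Finset.sum_le_sum fun j _ =>
          mul_le_of_le_one_right (hA i j) (mem_Icc_of_mem_stdSimplex hx j).2
  -- Collatz–Wielandt: the eigenvalue is the largest `r` with `r x ≤ A x` for some `x` in the
  -- simplex.
  let K : Set (ℝ × (V → ℝ)) :=
    (Set.Icc 0 C ×ˢ stdSimplex ℝ V) ∩ {p | ∀ i, p.1 * p.2 i ≤ (A *ᵥ p.2) i}
  have hK : IsCompact K := by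
    refine (isCompact_Icc.prod (isCompact_stdSimplex ℝ V)).inter_right ?_
    simp only [Set.ofPred_forall]
    refine isClosed_iInter fun i => isClosed_le (by fun_prop) ?_
    simp only [Matrix.mulVec, dotProduct]
    fun_prop
  have hne : K.Nonempty := by
    obtain ⟨i₀⟩ := ‹Nonempty V›
    have hs := single_mem_stdSimplex ℝ i₀
    have h0 : ∀ i, (0 : ℝ) * (Pi.single i₀ 1 : V → ℝ) i ≤ (A *ᵥ Pi.single i₀ 1) i := fun i => by
      rw [zero_mul]; exact mulVec_nonneg_of_nonneg hA hs.1 i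
    exact ⟨(0, Pi.single i₀ 1), ⟨⟨le_rfl, bound _ hs _ h0⟩, hs⟩, h0⟩
  obtain ⟨⟨r, x⟩, ⟨⟨hr, hx⟩, hrx⟩, hmax⟩ := hK.exists_isMaxOn hne continuous_fst.continuousOn
  simp only [Set.mem_ofPred_eq] at hr hx hrx
  obtain ⟨j, hj⟩ : ∃ j, 0 < x j := by
    by_contra! h
    have := hx.2
    have h2 := Finset.sum_nonpos fun i (_ : i ∈ Finset.univ) => h i
    linarith
  have hz := mulVec_add_self_pos hA hpos hx.1 hj
  have heq : A *ᵥ x = r • x := by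
    by_contra hne
    obtain ⟨l, hl⟩ := Function.ne_iff.1 hne
    set w : V → ℝ := A *ᵥ x - r • x with hw
    have hw0 : ∀ i, 0 ≤ w i := fun i => by simpa [hw] using hrx i
    have hwl : 0 < w l := lt_of_le_of_ne (hw0 l) fun h => hl (by
      simp only [hw, Pi.sub_apply] at h; linarith)
    obtain ⟨ε, hε, hle⟩ := exists_pos_mul_le (mulVec_add_self_pos hA hpos hw0 hwl) hz
    set z : V → ℝ := A *ᵥ x + x with hzdef
    have hAz : ∀ i, (r + ε) * z i ≤ (A *ᵥ z) i := fun i => by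
      have h1 : A *ᵥ w + w = A *ᵥ z - r • z := by
        simp only [hw, hzdef, Matrix.mulVec_sub, Matrix.mulVec_add, Matrix.mulVec_smul, smul_add]
        abel
      have h2 := congrFun h1 i
      have h3 := hle i
      simp only [Pi.add_apply, Pi.sub_apply, Pi.smul_apply, smul_eq_mul, hzdef] at h2 h3 ⊢
      linarith
    have hS : 0 < ∑ i, z i := Finset.sum_pos (fun i _ => hz i) Finset.univ_nonempty
    have hmem : (∑ i, z i)⁻¹ • z ∈ stdSimplex ℝ V :=
      ⟨fun i => mul_nonneg (inv_nonneg.2 hS.le) (hz i).le, by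
        simp only [Pi.smul_apply, smul_eq_mul, ← Finset.mul_sum]
        exact inv_mul_cancel₀ hS.ne'⟩
    have hle' : ∀ i, (r + ε) * ((∑ i, z i)⁻¹ • z) i ≤ (A *ᵥ ((∑ i, z i)⁻¹ • z)) i := fun i => by
      rw [Matrix.mulVec_smul, Pi.smul_apply, Pi.smul_apply, smul_eq_mul, smul_eq_mul,
        mul_left_comm]
      exact mul_le_mul_of_nonneg_left (hAz i) (inv_nonneg.2 hS.le)
    have := hmax (a := (r + ε, (∑ i, z i)⁻¹ • z))
      ⟨⟨⟨by linarith [hr.1], bound _ hmem _ hle'⟩, hmem⟩, hle'⟩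
    simp only [Set.mem_ofPred_eq] at this
    linarith
  refine ⟨r, x, hr.1, fun i => ?_, heq⟩
  have h1 := hz i
  rw [heq, Pi.smul_apply, smul_eq_mul] at h1
  have h2 : 0 < (r + 1) * x i := by linarith
  exact (pos_iff_pos_of_mul_pos h2).1 (by linarith [hr.1])

variable [DecidableEq V]

theorem mem_spectrum_iff_exists_mulVec {K : Type*} [Field K] (M : Matrix V V K) (t : K) :
    t ∈ spectrum K M ↔ ∃ v, v ≠ 0 ∧ M *ᵥ v = t • v := by
  rw [← Matrix.spectrum_toLin', ← Module.End.hasEigenvalue_iff_mem_spectrum]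
  constructor
  · intro h
    obtain ⟨v, hv⟩ := h.exists_hasEigenvector
    exact ⟨v, hv.2, by simpa using hv.apply_eq_smul⟩
  · rintro ⟨v, hv, h⟩
    exact Module.End.hasEigenvalue_of_hasEigenvector
      (Module.End.hasEigenvector_iff.2 ⟨Module.End.mem_eigenspace_iff.2 (by simpa using h), hv⟩)

/-- An eigenvector `v` for `t` satisfies `‖t‖ |v| ≤ A |v|` entrywise; pairing with `y` turns the
right side into `r` times the same positive number. -/
theorem spectralRadius_le_of_vecMul_eq {r : ℝ} {y : V → ℝ} (hA : ∀ i j, 0 ≤ A i j)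
    (hy : ∀ i, 0 < y i) (h : y ᵥ* A = r • y) :
    spectralRadius ℂ (A.map Complex.ofReal) ≤ ENNReal.ofReal r := by
  refine iSup₂_le fun t ht => ?_
  obtain ⟨v, hv, htv⟩ := (mem_spectrum_iff_exists_mulVec _ _).1 ht
  have hle : ∀ i, ‖t‖ * ‖v i‖ ≤ ∑ j, A i j * ‖v j‖ := fun i => by
    have h1 := congrFun htv i
    rw [Pi.smul_apply, smul_eq_mul] at h1
    rw [← norm_mul, ← h1]
    refine (norm_sum_le _ _).trans_eq (Finset.sum_congr rfl fun j _ => ?_)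
    simp [abs_of_nonneg (hA i j)]
  obtain ⟨l, hl⟩ := Function.ne_iff.1 hv
  have hpos : 0 < y ⬝ᵥ fun i => ‖v i‖ :=
    Finset.sum_pos' (fun i _ => mul_nonneg (hy i).le (norm_nonneg _))
      ⟨l, Finset.mem_univ _, mul_pos (hy l) (norm_pos_iff.2 hl)⟩
  have key : ‖t‖ * (y ⬝ᵥ fun i => ‖v i‖) ≤ r * (y ⬝ᵥ fun i => ‖v i‖) :=
    calc ‖t‖ * (y ⬝ᵥ fun i => ‖v i‖) = y ⬝ᵥ fun i => ‖t‖ * ‖v i‖ := by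
          simp only [dotProduct, Finset.mul_sum]
          exact Finset.sum_congr rfl fun i _ => by ring
      _ ≤ y ⬝ᵥ (A *ᵥ fun i => ‖v i‖) :=
          Finset.sum_le_sum fun i _ => mul_le_mul_of_nonneg_left (hle i) (hy i).le
      _ = r * (y ⬝ᵥ fun i => ‖v i‖) := by
          rw [Matrix.dotProduct_mulVec, h, smul_dotProduct, smul_eq_mul]
  rw [← enorm_eq_nnnorm, ← ofReal_norm]
  exact ENNReal.ofReal_le_ofReal (le_of_mul_le_mul_right key hpos)

theorem le_spectralRadius_of_mulVec_eq {r : ℝ} {x : V → ℝ} (hr : 0 ≤ r) (hx : x ≠ 0)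
    (h : A *ᵥ x = r • x) : ENNReal.ofReal r ≤ spectralRadius ℂ (A.map Complex.ofReal) := by
  have hmem : (r : ℂ) ∈ spectrum ℂ (A.map Complex.ofReal) := by
    refine (mem_spectrum_iff_exists_mulVec _ _).2 ⟨fun i => (x i : ℂ), fun h0 => hx ?_, ?_⟩
    · exact funext fun i => Complex.ofReal_eq_zero.1 (congrFun h0 i)
    · funext i
      have := congrArg Complex.ofReal (congrFun h i)
      simpa [Matrix.mulVec, dotProduct] using this
  refine le_trans ?_ (le_iSup₂ (f := fun (t : ℂ) (_ : t ∈ spectrum ℂ (A.map Complex.ofReal)) =>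
    (‖t‖₊ : ENNReal)) (r : ℂ) hmem)
  rw [← enorm_eq_nnnorm, ← ofReal_norm, Complex.norm_real, Real.norm_of_nonneg hr]

/-- Perron–Frobenius for a matrix whose off-diagonal entries are positive: the spectral radius has
positive right and left eigenvectors. -/
theorem exists_perron_vectors [Nonempty V] (hA : ∀ i j, 0 ≤ A i j)
    (hpos : ∀ i j, i ≠ j → 0 < A i j) :
    ∃ (r : ℝ) (x y : V → ℝ), 0 ≤ r ∧ (∀ i, 0 < x i) ∧ (∀ i, 0 < y i) ∧ A *ᵥ x = r • x ∧
      y ᵥ* A = r • y ∧ spectralRadius ℂ (A.map Complex.ofReal) = ENNReal.ofReal r := by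
  obtain ⟨r, x, hr, hx, hrx⟩ := exists_pos_eigenvector hA hpos
  obtain ⟨s, y, -, hy, hsy⟩ := exists_pos_eigenvector (A := Aᵀ) (fun i j => hA j i)
    (fun i j hij => hpos j i hij.symm)
  rw [Matrix.mulVec_transpose] at hsy
  have hxy : 0 < y ⬝ᵥ x :=
    Finset.sum_pos (fun i _ => mul_pos (hy i) (hx i)) Finset.univ_nonempty
  have hrs : r = s := by
    have := Matrix.dotProduct_mulVec y A x
    rw [hrx, hsy, dotProduct_smul, smul_dotProduct, smul_eq_mul, smul_eq_mul] at this
    exact mul_right_cancel₀ hxy.ne' this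
  subst hrs
  refine ⟨r, x, y, hr, hx, hy, hrx, hsy, le_antisymm (spectralRadius_le_of_vecMul_eq hA hy hsy)
    (le_spectralRadius_of_mulVec_eq hr ?_ hrx)⟩
  obtain ⟨i⟩ := ‹Nonempty V›
  exact fun h => (hx i).ne' (congrFun h i)

/-- Pair the inequality with the left Perron vector: all its entries are positive, so strictness in
one coordinate survives. -/
theorem spectralRadius_lt_of_mulVec_le [Nonempty V] (hA : ∀ i j, 0 ≤ A i j)
    (hpos : ∀ i j, i ≠ j → 0 < A i j) {c : ℝ} {z : V → ℝ} (hz : ∀ i, 0 < z i)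
    (hle : ∀ i, (A *ᵥ z) i ≤ c * z i) {j : V} (hlt : (A *ᵥ z) j < c * z j) :
    spectralRadius ℂ (A.map Complex.ofReal) < ENNReal.ofReal c := by
  obtain ⟨r, -, y, hr, -, hy, -, hry, hrad⟩ := exists_perron_vectors hA hpos
  rw [hrad]
  have hyz : 0 < y ⬝ᵥ z :=
    Finset.sum_pos (fun i _ => mul_pos (hy i) (hz i)) Finset.univ_nonempty
  have key : r * (y ⬝ᵥ z) < c * (y ⬝ᵥ z) :=
    calc r * (y ⬝ᵥ z) = y ⬝ᵥ (A *ᵥ z) := by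
          rw [Matrix.dotProduct_mulVec, hry, smul_dotProduct, smul_eq_mul]
      _ < y ⬝ᵥ fun i => c * z i :=
          Finset.sum_lt_sum (fun i _ => mul_le_mul_of_nonneg_left (hle i) (hy i).le)
            ⟨j, Finset.mem_univ _, mul_lt_mul_of_pos_left hlt (hy j)⟩
      _ = c * (y ⬝ᵥ z) := by
          simp only [dotProduct, Finset.mul_sum]
          exact Finset.sum_congr rfl fun i _ => by ring
  have hrc := lt_of_mul_lt_mul_right key hyz.le
  exact (ENNReal.ofReal_lt_ofReal_iff (hr.trans_lt hrc)).2 hrc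

theorem spectralRadius_lt_of_le_of_ne [Nonempty V] (hB : ∀ i j, 0 ≤ B i j)
    (hpos : ∀ i j, i ≠ j → 0 < B i j) (hle : ∀ i j, B i j ≤ A i j) (hne : B ≠ A) :
    spectralRadius ℂ (B.map Complex.ofReal) < spectralRadius ℂ (A.map Complex.ofReal) := by
  obtain ⟨r, x, -, -, hx, -, hrx, -, hrad⟩ := exists_perron_vectors (A := A)
    (fun i j => (hB i j).trans (hle i j)) (fun i j hij => (hpos i j hij).trans_le (hle i j))
  obtain ⟨a, b, hab⟩ : ∃ a b, B a b ≠ A a b := by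
    by_contra! h
    exact hne (Matrix.ext h)
  have hAx : ∀ i, (A *ᵥ x) i = r * x i := fun i => by rw [hrx]; rfl
  rw [hrad]
  refine spectralRadius_lt_of_mulVec_le hB hpos hx (j := a) (fun i => ?_) ?_
  · rw [← hAx]
    exact Finset.sum_le_sum fun j _ => mul_le_mul_of_nonneg_right (hle i j) (hx j).le
  · rw [← hAx]
    exact Finset.sum_lt_sum (fun j _ => mul_le_mul_of_nonneg_right (hle a j) (hx j).le)
      ⟨b, Finset.mem_univ _, mul_lt_mul_of_pos_right (lt_of_le_of_ne (hle a b) hab) (hx b)⟩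

theorem spectralRadius_reindex {W : Type*} [Fintype W] [DecidableEq W] (e : V ≃ W)
    (M : Matrix V V ℂ) : spectralRadius ℂ (Matrix.reindex e e M) = spectralRadius ℂ M := by
  simp only [spectralRadius]
  rw [← AlgEquiv.spectrum_eq (Matrix.reindexAlgEquiv ℂ ℂ e) M]
  rfl

end Matrix

/-! ### Walks, topological orders and normal forms for the two classes. -/

namespace Digraph

variable {V W : Type*} {G : Digraph V} {H : Digraph W}

theorem HasWalk.map {f : V → W} (hf : ∀ u v, G.Adj u v → H.Adj (f u) (f v)) {u v : V} {m : ℕ}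
    (p : G.HasWalk u v m) : H.HasWalk (f u) (f v) m := by
  induction p with
  | nil v => exact .nil _
  | cons h _ ih => exact .cons (hf _ _ h) ih

theorem HasWalk.append {u v w : V} {m l : ℕ} (p : G.HasWalk u v m) (q : G.HasWalk v w l) :
    G.HasWalk u w (m + l) := by
  induction p with
  | nil v => simpa using q
  | cons h _ ih => rw [Nat.add_right_comm]; exact .cons h (ih q)

theorem HasWalk.one {u v : V} (h : G.Adj u v) : G.HasWalk u v 1 := .cons h (.nil v)

theorem HasWalk.lt_of_adj_lt {f : V → ℕ} (hf : ∀ u v, G.Adj u v → f u < f v) {u v : V} {m : ℕ}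
    (p : G.HasWalk u v m) : f u + m ≤ f v := by
  induction p with
  | nil v => exact le_rfl
  | cons h _ ih => have := hf _ _ h; omega

theorem IsAcyclic.of_adj_lt (f : V → ℕ) (hf : ∀ u v, G.Adj u v → f u < f v) : G.IsAcyclic :=
  fun _ _ p => by have := p.lt_of_adj_lt hf; omega

/-- A finite acyclic digraph has a topological ordering. -/
theorem IsAcyclic.exists_topologicalOrder [Finite V] (hG : G.IsAcyclic) :
    ∃ e : V ≃ Fin (Nat.card V), ∀ u v, G.Adj u v → e u < e v := by
  classical
  have := Fintype.ofFinite V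
  let r : V → V → Prop := fun u v => ∃ m, G.HasWalk u v m
  have hr : IsPartialOrder V r :=
    { refl := fun u => ⟨0, .nil u⟩
      trans := fun u v w ⟨_, p⟩ ⟨_, q⟩ => ⟨_, p.append q⟩
      antisymm := fun u v ⟨m, p⟩ ⟨l, q⟩ => by
        cases p with
        | nil => rfl
        | @cons _ _ _ m h p =>
          exact absurd (Nat.add_right_comm m 1 l ▸ (HasWalk.cons h p).append q) (hG u (m + l)) }
  obtain ⟨s, hs, hrs⟩ := extend_partialOrder r
  let _ : LinearOrder V :=
    { le := s
      le_refl := hs.refl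
      le_trans := hs.trans
      le_antisymm := hs.antisymm
      le_total := hs.total
      toDecidableLE := Classical.decRel _ }
  let e : Fin (Nat.card V) ≃o V := Fintype.orderIsoFinOfCardEq V Nat.card_eq_fintype_card.symm
  refine ⟨e.symm.toEquiv, fun u v h => e.symm.lt_iff_lt.2 (lt_of_le_of_ne ?_ ?_)⟩
  · exact hrs _ _ ⟨1, .one h⟩
  · rintro rfl
    exact hG u 0 (.one h)

theorem outdegree_eq_of_adj_iff_lt {m : ℕ} (e : V ≃ Fin m) (he : ∀ u v, G.Adj u v ↔ e u < e v)
    (u : V) : G.outdegree u = m - 1 - e u := by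
  have : {w | G.Adj u w} = e.symm '' Set.Ioi (e u) := by
    ext w
    simp [he]
  rw [outdegree, this, Set.ncard_image_of_injective _ e.symm.injective,
    Set.ncard_eq_toFinset_card']
  simp

theorem isTransitiveTournament_of_adj_iff_lt {m : ℕ} (e : V ≃ Fin m)
    (he : ∀ u v, G.Adj u v ↔ e u < e v) : G.IsTransitiveTournament := by
  refine ⟨⟨fun v => by simp [he], fun u v huv => ?_⟩, ?_⟩
  · rcases lt_or_gt_of_ne (e.injective.ne huv) with h | h
    · exact .inl ⟨(he _ _).2 h, by rw [he]; exact h.not_gt⟩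
    · exact .inr ⟨(he _ _).2 h, by rw [he]; exact h.not_gt⟩
  · have hm : Nat.card V = m := by rw [Nat.card_congr e, Nat.card_eq_fintype_card, Fintype.card_fin]
    rw [hm]
    ext d
    simp only [Set.mem_range, Set.mem_Iio, outdegree_eq_of_adj_iff_lt e he]
    constructor
    · rintro ⟨u, rfl⟩
      have := (e u).2
      omega
    · intro hd
      exact ⟨e.symm ⟨m - 1 - d, by omega⟩, by simp; omega⟩

/-- By induction, a vertex of smaller outdegree has no arc to `v`, so `v` has an arc to it. There
are exactly `outdegree v` such vertices, hence no other out-neighbours. -/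
theorem IsTransitiveTournament.adj_iff_outdegree_lt [Finite V] (hG : G.IsTransitiveTournament)
    (hinj : Function.Injective G.outdegree) (v : V) :
    ∀ w, G.Adj v w ↔ G.outdegree w < G.outdegree v := by
  obtain ⟨⟨hs, ht⟩, hrange⟩ := hG
  induction hd : G.outdegree v using Nat.strong_induction_on generalizing v with
  | _ d ih =>
    have hsub : {w | G.outdegree w < d} ⊆ {w | G.Adj v w} := fun w hw => by
      have hw : G.outdegree w < d := hw
      have hne : v ≠ w := by rintro rfl; omega
      rcases ht v w hne with h | h
      · exact h.1
      · have := (ih _ hw w rfl v).1 h.1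
        omega
    have hdlt : d < Nat.card V := by
      have : d ∈ Set.range G.outdegree := ⟨v, hd⟩
      rwa [hrange] at this
    have hcard : {w | G.outdegree w < d}.ncard = d := by
      have himg : G.outdegree '' {w | G.outdegree w < d} = Set.Iio d := by
        ext j
        constructor
        · rintro ⟨w, hw, rfl⟩
          exact hw
        · intro hj
          have : j ∈ Set.range G.outdegree := by
            rw [hrange]
            exact lt_trans hj hdlt
          obtain ⟨w, rfl⟩ := this
          exact ⟨w, hj, rfl⟩
      rw [← Set.ncard_image_of_injective _ hinj, himg, Set.ncard_eq_toFinset_card']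
      simp
    have heq := Set.eq_of_subset_of_ncard_le hsub (by rw [hcard]; exact hd.le) (Set.toFinite _)
    intro w
    exact (Set.ext_iff.1 heq w).symm

theorem IsTransitiveTournament.exists_equiv [Finite V] (hG : G.IsTransitiveTournament) :
    ∃ e : V ≃ Fin (Nat.card V), ∀ u v, G.Adj u v ↔ e u < e v := by
  have := Fintype.ofFinite V
  have hlt : ∀ v, G.outdegree v < Nat.card V := fun v => by
    have : G.outdegree v ∈ Set.range G.outdegree := ⟨v, rfl⟩
    rwa [hG.2] at this
  let f : V → Fin (Nat.card V) := fun v => ⟨G.outdegree v, hlt v⟩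
  have hf : Function.Surjective f := fun d => by
    have : (d : ℕ) ∈ Set.range G.outdegree := by rw [hG.2]; exact d.2
    obtain ⟨v, hv⟩ := this
    exact ⟨v, Fin.ext hv⟩
  have hbij : Function.Bijective f :=
    (Fintype.bijective_iff_surjective_and_card f).2
      ⟨hf, by rw [Fintype.card_fin, Nat.card_eq_fintype_card]⟩
  have hinj : Function.Injective G.outdegree := fun u v h => hbij.1 (Fin.ext h)
  -- Outdegrees decrease along arcs, hence the reversal.
  refine ⟨(Equiv.ofBijective f hbij).trans Fin.revPerm, fun u v => ?_⟩
  rw [hG.adj_iff_outdegree_lt hinj]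
  have h1 := hlt u
  have h2 := hlt v
  simp only [Equiv.trans_apply, Equiv.ofBijective_apply, Fin.revPerm_apply, Fin.lt_def,
    Fin.val_rev, f]
  omega

/-- The join of transitive tournaments of orders `m i`, each with arcs in increasing order. -/
def layeredJoin {k : ℕ} (m : Fin k → ℕ) : Digraph (Σ i, Fin (m i)) where
  Adj u v := u.1 ≠ v.1 ∨ (u.2 : ℕ) < v.2

theorem exists_equiv_sigma {k : ℕ} (c : V → Fin k) {m : Fin k → ℕ}
    (e : ∀ i, (c ⁻¹' {i} : Set V) ≃ Fin (m i)) :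
    ∃ E : V ≃ Σ i, Fin (m i), (∀ u, (E u).1 = c u) ∧
      ∀ i (u : (c ⁻¹' {i} : Set V)), ((E u).2 : ℕ) = e i u := by
  refine ⟨(Equiv.sigmaFiberEquiv c).symm.trans (Equiv.sigmaCongrRight e), fun u => rfl, ?_⟩
  rintro i ⟨u, rfl⟩
  rfl

theorem IsAcyclicColoring.exists_equiv [Finite V] {k : ℕ} {c : V → Fin k}
    (hc : G.IsAcyclicColoring c) :
    ∃ E : V ≃ Σ i, Fin (c ⁻¹' {i}).ncard, (∀ u, (E u).1 = c u) ∧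
      ∀ u v, G.Adj u v → (layeredJoin fun i => (c ⁻¹' {i}).ncard).Adj (E u) (E v) := by
  choose e he using fun i => (hc i).exists_topologicalOrder
  obtain ⟨E, hE, hE2⟩ := exists_equiv_sigma c (m := fun i => (c ⁻¹' {i}).ncard) e
  refine ⟨E, hE, fun u v huv => ?_⟩
  by_cases h : c u = c v
  · refine .inr ?_
    rw [hE2 (c v) ⟨u, h⟩, hE2 (c v) ⟨v, rfl⟩]
    exact he (c v) ⟨u, h⟩ ⟨v, rfl⟩ huv
  · exact .inl (by rwa [hE, hE])

theorem IsTournamentJoin.exists_equiv [Finite V] {k : ℕ} {c : V → Fin k}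
    (hc : G.IsTournamentJoin c) :
    ∃ E : V ≃ Σ i, Fin (c ⁻¹' {i}).ncard,
      ∀ u v, G.Adj u v ↔ (layeredJoin fun i => (c ⁻¹' {i}).ncard).Adj (E u) (E v) := by
  choose e he using fun i => (hc.2.1 i).exists_equiv
  obtain ⟨E, hE, hE2⟩ := exists_equiv_sigma c (m := fun i => (c ⁻¹' {i}).ncard) e
  refine ⟨E, fun u v => ?_⟩
  simp only [layeredJoin, hE]
  by_cases h : c u = c v
  · rw [hE2 (c v) ⟨u, h⟩, hE2 (c v) ⟨v, rfl⟩]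
    simp only [h, ne_eq, not_true_eq_false, false_or]
    exact he (c v) ⟨u, h⟩ ⟨v, rfl⟩
  · simpa [h] using (hc.2.2 u v h).1

theorem exists_class_equiv {k : ℕ} {m : Fin k → ℕ} (E : V ≃ Σ i, Fin (m i)) (i : Fin k) :
    ∃ e : ((fun u => (E u).1) ⁻¹' {i} : Set V) ≃ Fin (m i),
      ∀ u, ((e u : Fin (m i)) : ℕ) = (E u).2 := by
  refine ⟨(E.subtypeEquiv (p := fun u => (E u).1 = i) (q := fun s => s.1 = i)
    fun _ => Iff.rfl).trans (Equiv.sigmaSubtype i), ?_⟩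
  rintro ⟨u, rfl⟩
  rfl

theorem isTournamentJoin_of_equiv {k : ℕ} {m : Fin k → ℕ} (hm : ∀ i, 0 < m i)
    (E : V ≃ Σ i, Fin (m i)) (hE : ∀ u v, G.Adj u v ↔ (layeredJoin m).Adj (E u) (E v)) :
    G.IsTournamentJoin fun u => (E u).1 := by
  refine ⟨fun i => ⟨E.symm ⟨i, 0, hm i⟩, by simp⟩, fun i => ?_, fun u v huv => ?_⟩
  · obtain ⟨e, he⟩ := exists_class_equiv E i
    refine isTransitiveTournament_of_adj_iff_lt e fun u v => ?_
    have huv : (E u).1 = (E v).1 := u.2.trans v.2.symm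
    rw [Fin.lt_def, he, he]
    exact (hE u v).trans (by simp [layeredJoin, huv])
  · simp only [hE]
    exact ⟨.inl huv, .inl huv.symm⟩

theorem ncard_class {k : ℕ} {m : Fin k → ℕ} (E : V ≃ Σ i, Fin (m i)) (i : Fin k) :
    ((fun u => (E u).1) ⁻¹' {i}).ncard = m i := by
  obtain ⟨e, -⟩ := exists_class_equiv E i
  rw [← Nat.card_coe_set_eq, Nat.card_congr e, Nat.card_eq_fintype_card, Fintype.card_fin]

theorem Isomorphic.symm (h : G.Isomorphic H) : H.Isomorphic G := h.map RelIso.symm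

theorem Isomorphic.trans {U : Type*} {K : Digraph U} (h : G.Isomorphic H) (h' : H.Isomorphic K) :
    G.Isomorphic K := h.elim fun e => h'.map e.trans

theorem IsTournamentJoin.ncard_class_pos {k : ℕ} {c : V → Fin k} (hc : G.IsTournamentJoin c)
    [Finite V] (i : Fin k) : 0 < (c ⁻¹' {i}).ncard := by
  obtain ⟨u, rfl⟩ := hc.1 i
  exact (Set.ncard_pos (Set.toFinite _)).2 ⟨u, rfl⟩

theorem memT_iff [Fintype V] {n k : ℕ} : G.MemT n k ↔
    ∃ m : Fin k → ℕ, (∀ i, 0 < m i) ∧ ∑ i, m i = n ∧ G.Isomorphic (layeredJoin m) := by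
  constructor
  · rintro ⟨hn, c, hc⟩
    obtain ⟨E, hE⟩ := hc.exists_equiv
    refine ⟨_, hc.ncard_class_pos, ?_, ⟨⟨E, fun {u v} => (hE u v).symm⟩⟩⟩
    rw [← hn, Fintype.card_congr E, Fintype.card_sigma]
    simp
  · rintro ⟨m, hm, hn, ⟨E⟩⟩
    refine ⟨?_, _, isTournamentJoin_of_equiv hm E.toEquiv fun u v => E.map_rel_iff.symm⟩
    rw [← hn, Fintype.card_congr E.toEquiv, Fintype.card_sigma]
    simp

theorem memTStar_iff [Fintype V] {n k : ℕ} : G.MemTStar n k ↔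
    ∃ m : Fin k → ℕ, (∀ i, 0 < m i) ∧ (∀ i j, m i ≤ m j + 1) ∧ ∑ i, m i = n ∧
      G.Isomorphic (layeredJoin m) := by
  constructor
  · rintro ⟨hn, c, hc, hbal⟩
    obtain ⟨E, hE⟩ := hc.exists_equiv
    refine ⟨_, hc.ncard_class_pos, hbal, ?_, ⟨⟨E, fun {u v} => (hE u v).symm⟩⟩⟩
    rw [← hn, Fintype.card_congr E, Fintype.card_sigma]
    simp
  · rintro ⟨m, hm, hbal, hn, ⟨E⟩⟩
    refine ⟨?_, _, isTournamentJoin_of_equiv hm E.toEquiv fun u v => E.map_rel_iff.symm,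
      fun i j => ?_⟩
    · rw [← hn, Fintype.card_congr E.toEquiv, Fintype.card_sigma]
      simp
    · rw [ncard_class, ncard_class]
      exact hbal i j

/-! ### Distances and monotonicity of the `D_α` spectral radius. -/

variable {V W : Type*} {G : Digraph V} {H : Digraph W}

theorem dist_le {u v : V} {m : ℕ} (p : G.HasWalk u v m) : G.dist u v ≤ m := Nat.sInf_le p

theorem IsStronglyConnected.hasWalk_dist (hG : G.IsStronglyConnected) (u v : V) :
    G.HasWalk u v (G.dist u v) :=
  Nat.sInf_mem (s := {m | G.HasWalk u v m}) (hG u v)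

theorem dist_self (v : V) : G.dist v v = 0 := Nat.le_zero.1 (dist_le (.nil v))

theorem IsStronglyConnected.dist_pos (hG : G.IsStronglyConnected) {u v : V} (h : u ≠ v) :
    0 < G.dist u v := by
  by_contra! h0
  have p := hG.hasWalk_dist u v
  rw [Nat.le_zero.1 h0] at p
  cases p
  exact h rfl

theorem IsStronglyConnected.dist_eq_one (hG : G.IsStronglyConnected) {u v : V} (h : u ≠ v)
    (hadj : G.Adj u v) : G.dist u v = 1 :=
  le_antisymm (dist_le (.one hadj)) (hG.dist_pos h)

theorem IsStronglyConnected.one_lt_dist (hG : G.IsStronglyConnected) {u v : V} (h : u ≠ v)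
    (hadj : ¬ G.Adj u v) : 1 < G.dist u v := by
  by_contra! h1
  have p := hG.hasWalk_dist u v
  rw [le_antisymm h1 (hG.dist_pos h)] at p
  cases p with
  | cons a q =>
    cases q
    exact hadj a

theorem IsStronglyConnected.dist_map_le (hG : G.IsStronglyConnected) {f : V → W}
    (hf : ∀ u v, G.Adj u v → H.Adj (f u) (f v)) (u v : V) : H.dist (f u) (f v) ≤ G.dist u v :=
  dist_le ((hG.hasWalk_dist u v).map hf)

theorem dist_map (e : G.Adj ≃r H.Adj) (u v : V) : H.dist (e u) (e v) = G.dist u v := by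
  unfold dist
  congr 1
  ext m
  refine ⟨fun p => ?_, fun p => p.map fun _ _ => e.map_rel_iff.2⟩
  have := p.map (H := G) (f := e.symm) fun _ _ => e.symm.map_rel_iff.2
  simpa using this

variable [Fintype V] [DecidableEq V] [Fintype W] [DecidableEq W]

theorem alphaDistMatrix_apply (α : ℝ) (u v : V) : G.alphaDistMatrix α u v =
    α * (if u = v then ∑ w, (G.dist u w : ℝ) else 0) + (1 - α) * G.dist u v := by
  simp [alphaDistMatrix, distMatrix, transmission, Matrix.diagonal_apply]

theorem alphaDistMatrix_nonneg {α : ℝ} (h0 : 0 ≤ α) (h1 : α < 1) (u v : V) :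
    0 ≤ G.alphaDistMatrix α u v := by
  rw [alphaDistMatrix_apply]
  have : 0 ≤ 1 - α := by linarith
  split_ifs <;> positivity

theorem IsStronglyConnected.alphaDistMatrix_pos (hG : G.IsStronglyConnected) {α : ℝ}
    (h1 : α < 1) {u v : V} (h : u ≠ v) : 0 < G.alphaDistMatrix α u v := by
  rw [alphaDistMatrix_apply, if_neg h, mul_zero, zero_add]
  exact mul_pos (by linarith) (Nat.cast_pos.2 (hG.dist_pos h))

theorem Isomorphic.alphaSpectralRadius_eq (h : G.Isomorphic H) (α : ℝ) :
    G.alphaSpectralRadius α = H.alphaSpectralRadius α := by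
  obtain ⟨e⟩ := h
  unfold alphaSpectralRadius
  rw [← Matrix.spectralRadius_reindex e.symm.toEquiv ((H.alphaDistMatrix α).map Complex.ofReal)]
  congr 1
  ext u v
  simp only [Matrix.map_apply, Matrix.reindex_apply, Matrix.submatrix_apply,
    alphaDistMatrix_apply]
  change _ = ((α * (if e u = e v then ∑ w, (H.dist (e u) w : ℝ) else 0) +
    (1 - α) * H.dist (e u) (e v) : ℝ) : ℂ)
  rw [← e.toEquiv.sum_comp]
  simp [dist_map, e.injective.eq_iff]

/-- Adding arcs to a strongly connected digraph decreases the `D_α` spectral radius strictly. -/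
theorem IsStronglyConnected.alphaSpectralRadius_lt [Nonempty V] {G' : Digraph V}
    (hG : G.IsStronglyConnected) (hG' : G'.IsStronglyConnected)
    (hle : ∀ u v, G.Adj u v → G'.Adj u v) {a b : V} (hab : a ≠ b) (hadj : G'.Adj a b)
    (hnadj : ¬ G.Adj a b) {α : ℝ} (h0 : 0 ≤ α) (h1 : α < 1) :
    G'.alphaSpectralRadius α < G.alphaSpectralRadius α := by
  have hd : ∀ u v, (G'.dist u v : ℝ) ≤ G.dist u v := fun u v =>
    Nat.cast_le.2 (hG.dist_map_le (f := id) hle u v)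
  have hα : 0 < 1 - α := by linarith
  refine Matrix.spectralRadius_lt_of_le_of_ne (alphaDistMatrix_nonneg h0 h1)
    (fun u v => hG'.alphaDistMatrix_pos h1) (fun u v => ?_) fun h => ?_
  · rw [alphaDistMatrix_apply, alphaDistMatrix_apply]
    have hs : (if u = v then ∑ w, (G'.dist u w : ℝ) else 0) ≤
        if u = v then ∑ w, (G.dist u w : ℝ) else 0 := by
      split_ifs
      · exact Finset.sum_le_sum fun w _ => hd u w
      · exact le_rfl
    exact add_le_add (mul_le_mul_of_nonneg_left hs h0) (mul_le_mul_of_nonneg_left (hd u v) hα.le)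
  · have hab' := congrFun (congrFun h a) b
    simp only [alphaDistMatrix_apply, if_neg hab, mul_zero, zero_add, hG'.dist_eq_one hab hadj]
      at hab'
    have h3 := mul_left_cancel₀ hα.ne' hab'
    have := hG.one_lt_dist hab hnadj
    have h4 : 1 = G.dist a b := by exact_mod_cast h3
    omega

/-! ### Distances, `D_α` rows and dichromatic number of a join. -/

section layeredJoin

variable {k : ℕ} {m : Fin k → ℕ}

theorem layeredJoin_isSimple : (layeredJoin m).IsSimple := fun v => by simp [layeredJoin]

theorem layeredJoin_hasWalk_two (hk : 2 ≤ k) (hm : ∀ i, 0 < m i) {u v : Σ i, Fin (m i)}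
    (h : u.1 = v.1) : (layeredJoin m).HasWalk u v 2 := by
  have : Nontrivial (Fin k) := Fin.nontrivial_iff_two_le.2 hk
  obtain ⟨i, hi⟩ := exists_ne u.1
  exact .cons (v := ⟨i, 0, hm i⟩) (.inl hi.symm) (.one (.inl (h ▸ hi)))

theorem layeredJoin_isStronglyConnected (hk : 2 ≤ k) (hm : ∀ i, 0 < m i) :
    (layeredJoin m).IsStronglyConnected := fun u v => by
  by_cases h : u.1 = v.1
  · exact ⟨2, layeredJoin_hasWalk_two hk hm h⟩
  · exact ⟨1, .one (.inl h)⟩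

theorem layeredJoin_dist (hk : 2 ≤ k) (hm : ∀ i, 0 < m i) (u v : Σ i, Fin (m i)) :
    ((layeredJoin m).dist u v : ℝ) = 1 - (if u = v then 1 else 0) +
      if u.1 = v.1 ∧ (v.2 : ℕ) < u.2 then 1 else 0 := by
  have hsc := layeredJoin_isStronglyConnected hk hm
  rcases eq_or_ne u v with rfl | huv
  · simp [dist_self]
  by_cases hadj : (layeredJoin m).Adj u v
  · have : ¬ (u.1 = v.1 ∧ (v.2 : ℕ) < u.2) := by
      rintro ⟨h1, h2⟩
      exact hadj.elim (fun h => h h1) fun h => by omega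
    simp [hsc.dist_eq_one huv hadj, huv, this]
  · have h1 : u.1 = v.1 := by_contra fun h => hadj (.inl h)
    have h2 : (v.2 : ℕ) < u.2 := by
      by_contra! h
      rcases h.lt_or_eq with h | h
      · exact hadj (.inr h)
      · obtain ⟨i, p⟩ := u
        obtain ⟨j, q⟩ := v
        obtain rfl : i = j := h1
        exact huv (congrArg (Sigma.mk i) (Fin.ext h))
    have hd : (layeredJoin m).dist u v = 2 :=
      le_antisymm (dist_le (layeredJoin_hasWalk_two hk hm h1)) (hsc.one_lt_dist huv hadj)
    rw [if_neg huv, if_pos ⟨h1, h2⟩, hd]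
    norm_num

theorem sum_sigma_lt (u : Σ i, Fin (m i)) (x : (Σ i, Fin (m i)) → ℝ) :
    ∑ v, (if u.1 = v.1 ∧ (v.2 : ℕ) < u.2 then x v else 0) =
      ∑ q : Fin (m u.1), if q < u.2 then x ⟨u.1, q⟩ else 0 := by
  rw [Fintype.sum_sigma, Finset.sum_eq_single u.1]
  · exact Finset.sum_congr rfl fun q _ => by simp
  · intro i _ hi
    exact Finset.sum_eq_zero fun q _ => if_neg fun h => hi h.1.symm
  · simp

theorem sum_fin_lt {M : ℕ} (p : Fin M) (g : ℕ → ℝ) :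
    ∑ q : Fin M, (if q < p then g q else 0) = ∑ q ∈ Finset.range p, g q := by
  have h := Fin.sum_univ_eq_sum_range (fun q => if q < (p : ℕ) then g q else 0) M
  simp only [Fin.lt_def, h, ← Finset.sum_filter]
  congr 1
  ext q
  have := p.2
  simp only [Finset.mem_filter, Finset.mem_range]
  omega

/-- Only the vertices earlier in the class of `u` are at distance 2, so the transmission is the
order minus 1 plus the position. -/
theorem layeredJoin_mulVec (hk : 2 ≤ k) (hm : ∀ i, 0 < m i) (α : ℝ)
    (x : (Σ i, Fin (m i)) → ℝ) (u : Σ i, Fin (m i)) :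
    ((layeredJoin m).alphaDistMatrix α).mulVec x u =
      α * (((∑ i, m i : ℕ) : ℝ) - 1 + (u.2 : ℕ)) * x u +
        (1 - α) * (∑ v, x v - x u +
          ∑ q : Fin (m u.1), if q < u.2 then x ⟨u.1, q⟩ else 0) := by
  have htr : ∑ w, ((layeredJoin m).dist u w : ℝ) = ((∑ i, m i : ℕ) : ℝ) - 1 + (u.2 : ℕ) := by
    simp only [layeredJoin_dist hk hm, Finset.sum_add_distrib, Finset.sum_sub_distrib,
      sum_sigma_lt u fun _ => 1]
    rw [sum_fin_lt u.2 fun _ => 1]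
    simp
  simp only [Matrix.mulVec, dotProduct, alphaDistMatrix_apply, htr, add_mul,
    Finset.sum_add_distrib]
  congr 1
  · simp
  · rw [← sum_sigma_lt]
    simp only [mul_assoc, ← Finset.mul_sum, layeredJoin_dist hk hm, add_mul, sub_mul,
      Finset.sum_add_distrib, Finset.sum_sub_distrib, ite_mul, one_mul, zero_mul]
    simp

theorem layeredJoin_dichromaticNumber (hm : ∀ i, 0 < m i) :
    (layeredJoin m).dichromaticNumber = k := by
  have hfst : (layeredJoin m).IsAcyclicColoring Sigma.fst := fun i =>
    .of_adj_lt (fun u => (u.1.2 : ℕ)) fun u v h =>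
      h.resolve_left fun h => h (u.2.trans v.2.symm)
  refine le_antisymm (Nat.sInf_le ⟨_, hfst⟩) (le_csInf ⟨k, _, hfst⟩ ?_)
  · rintro j ⟨c, hc⟩
    -- The first vertices of two classes form a 2-cycle, so they cannot share a colour.
    have hinj : Function.Injective fun i : Fin k => c ⟨i, 0, hm i⟩ := fun i i' h => by
      by_contra hne
      let a : (c ⁻¹' {c ⟨i', 0, hm i'⟩} : Set _) := ⟨⟨i, 0, hm i⟩, h⟩
      let b : (c ⁻¹' {c ⟨i', 0, hm i'⟩} : Set _) := ⟨⟨i', 0, hm i'⟩, rfl⟩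
      exact hc _ a 1 (.cons (v := b) (.inl hne) (.one (.inl (Ne.symm hne))))
    simpa using Fintype.card_le_of_injective _ hinj

end layeredJoin

/-! ### Discrete convexity of partial sums. -/

section partialSums

variable {g : ℕ → ℝ} {M q : ℕ}

theorem add_mul_le_sum_range_add (hg : StrictMonoOn g (Set.Iio M)) (t : ℕ) (ht : q + t ≤ M) :
    ∑ p ∈ Finset.range q, g p + t * g q ≤ ∑ p ∈ Finset.range (q + t), g p ∧
      (2 ≤ t → ∑ p ∈ Finset.range q, g p + t * g q < ∑ p ∈ Finset.range (q + t), g p) := by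
  induction t with
  | zero => simp
  | succ t ih =>
    obtain ⟨h1, -⟩ := ih (by omega)
    rw [← add_assoc, Finset.sum_range_succ]
    push_cast
    rcases t.eq_zero_or_pos with rfl | h0
    · simp
    · have := hg (a := q) (b := q + t) (by simp; omega) (by simp; omega) (by omega)
      exact ⟨by linarith, fun _ => by linarith⟩

theorem sum_range_add_le (hg : StrictMonoOn g (Set.Iio M)) (hq : q < M) (t : ℕ) {j : ℕ}
    (ht : j + t = q) :
    ∑ p ∈ Finset.range q, g p ≤ ∑ p ∈ Finset.range j, g p + t * g q ∧
      (1 ≤ t → ∑ p ∈ Finset.range q, g p < ∑ p ∈ Finset.range j, g p + t * g q) := by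
  induction t generalizing j with
  | zero => simp [← ht]
  | succ t ih =>
    obtain ⟨h1, -⟩ := ih (j := j + 1) (by omega)
    rw [Finset.sum_range_succ] at h1
    push_cast
    have := hg (a := j) (b := q) (by simp; omega) (by simpa using hq) (by omega)
    exact ⟨by linarith, fun _ => by linarith⟩

/-- Partial sums of a strictly increasing sequence lie above their tangent lines. -/
theorem tangent_le_sum_range (hg : StrictMonoOn g (Set.Iio M)) (hq : q < M) {j : ℕ} (hj : j ≤ M) :
    ∑ p ∈ Finset.range q, g p + ((j : ℝ) - q) * g q ≤ ∑ p ∈ Finset.range j, g p ∧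
      (j ≠ q → j ≠ q + 1 →
        ∑ p ∈ Finset.range q, g p + ((j : ℝ) - q) * g q < ∑ p ∈ Finset.range j, g p) := by
  rcases le_total q j with h | h
  · obtain ⟨t, rfl⟩ := Nat.exists_eq_add_of_le h
    have := add_mul_le_sum_range_add hg t hj
    rw [Nat.cast_add, add_sub_cancel_left]
    exact ⟨this.1, fun h1 h2 => this.2 (by omega)⟩
  · obtain ⟨t, rfl⟩ := Nat.exists_eq_add_of_le h
    have := sum_range_add_le hg hq t rfl
    rw [Nat.cast_add]
    exact ⟨by linarith [this.1], fun h1 _ => by linarith [this.2 (by omega)]⟩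

/-- Compare with the tangent at `q = min m'`. It is exact at `q` and `q + 1`, the only balanced
sizes, and its total depends only on the sum of the sizes; an unbalanced `m` has a size where it is
strict. -/
theorem sum_sum_range_lt_of_balanced {k : ℕ} {m m' : Fin k → ℕ}
    (hg : StrictMonoOn g (Set.Iio M)) (hM : ∀ i, m i ≤ M) (hsum : ∑ i, m i = ∑ i, m' i)
    (hbal' : ∀ i j, m' i ≤ m' j + 1) (hbal : ¬ ∀ i j, m i ≤ m j + 1) :
    (∀ i, m' i ≤ M) ∧
      ∑ i, ∑ p ∈ Finset.range (m' i), g p < ∑ i, ∑ p ∈ Finset.range (m i), g p := by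
  push Not at hbal
  obtain ⟨a, b, hab⟩ := hbal
  have : Nonempty (Fin k) := ⟨a⟩
  obtain ⟨i₀, hi₀⟩ := Finite.exists_min m'
  set q := m' i₀ with hq
  -- Otherwise `m ≤ M ≤ m'` with equal sums forces `m = m'`, which is balanced.
  have hqM : q < M := by
    by_contra! h
    have h1 : ∀ i, m i ≤ m' i := fun i => (hM i).trans (h.trans (hi₀ i))
    have h2 := (Finset.sum_eq_sum_iff_of_le fun i _ => h1 i).1 hsum
    have := h2 a (Finset.mem_univ _)
    have := h2 b (Finset.mem_univ _)
    have := hbal' a b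
    omega
  have hm' : ∀ i, m' i = q ∨ m' i = q + 1 := fun i => by
    have := hi₀ i
    have := hbal' i i₀
    omega
  refine ⟨fun i => by rcases hm' i with h | h <;> omega, ?_⟩
  have hF' : ∀ i, ∑ p ∈ Finset.range (m' i), g p =
      ∑ p ∈ Finset.range q, g p + ((m' i : ℝ) - q) * g q := fun i => by
    rcases hm' i with h | h <;> simp [h, Finset.sum_range_succ]
  have hlin : ∑ i, (∑ p ∈ Finset.range q, g p + ((m' i : ℝ) - q) * g q) =
      ∑ i, (∑ p ∈ Finset.range q, g p + ((m i : ℝ) - q) * g q) := by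
    have hs : ∑ i, (m i : ℝ) = ∑ i, (m' i : ℝ) := by exact_mod_cast hsum
    simp only [Finset.sum_add_distrib, ← Finset.sum_mul, Finset.sum_sub_distrib, hs]
  rw [Finset.sum_congr rfl fun i _ => hF' i, hlin]
  obtain ⟨c, hc, hc'⟩ : ∃ c, m c ≠ q ∧ m c ≠ q + 1 := by
    by_contra! h
    have := h a
    have := h b
    omega
  exact Finset.sum_lt_sum (fun i _ => (tangent_le_sum_range hg hqM (hM i)).1)
    ⟨c, Finset.mem_univ _, (tangent_le_sum_range hg hqM (hM c)).2 hc hc'⟩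

end partialSums

/-! ### Balancing the class sizes. -/

variable {k : ℕ} {m m' : Fin k → ℕ}

theorem layeredJoin_alphaSpectralRadius_lt (hk : 2 ≤ k) (hm : ∀ i, 0 < m i) (hm' : ∀ i, 0 < m' i)
    (hsum : ∑ i, m i = ∑ i, m' i) (hbal' : ∀ i j, m' i ≤ m' j + 1)
    (hbal : ¬ ∀ i j, m i ≤ m j + 1) {α : ℝ} (h0 : 0 ≤ α) (h1 : α < 1) :
    (layeredJoin m').alphaSpectralRadius α < (layeredJoin m).alphaSpectralRadius α := by
  have : Nonempty (Fin k) := ⟨⟨0, by omega⟩⟩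
  have hne : Nonempty (Σ i, Fin (m i)) := ⟨⟨Classical.arbitrary _, 0, hm _⟩⟩
  have hne' : Nonempty (Σ i, Fin (m' i)) := ⟨⟨Classical.arbitrary _, 0, hm' _⟩⟩
  obtain ⟨r, x, -, -, hx, -, hrx, -, hrad⟩ := Matrix.exists_perron_vectors
    (A := (layeredJoin m).alphaDistMatrix α) (alphaDistMatrix_nonneg h0 h1)
    (fun u v => (layeredJoin_isStronglyConnected hk hm).alphaDistMatrix_pos h1)
  rw [alphaSpectralRadius, alphaSpectralRadius, hrad]
  have hβ : 0 < 1 - α := by linarith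
  set S := ∑ v, x v with hS
  have hSpos : 0 < S := Finset.sum_pos (fun v _ => hx v) Finset.univ_nonempty
  -- The coefficient of `x u` once the diagonal terms of the eigenvalue equation are moved to the
  -- side of `r`.
  let a : ℕ → ℝ := fun p => r + (1 - α) - α * (((∑ i, m i : ℕ) : ℝ) - 1 + p)
  have hanti : ∀ {p q : ℕ}, p ≤ q → a q ≤ a p := fun {p q} hpq => by
    have : (p : ℝ) ≤ q := Nat.cast_le.2 hpq
    have := mul_le_mul_of_nonneg_left this h0
    simp only [a]
    linarith
  have hrec : ∀ u : Σ i, Fin (m i), a u.2 * x u =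
      (1 - α) * (S + ∑ q : Fin (m u.1), if q < u.2 then x ⟨u.1, q⟩ else 0) := fun u => by
    have h := congrFun hrx u
    rw [layeredJoin_mulVec hk hm, Pi.smul_apply, smul_eq_mul, ← hS] at h
    simp only [a]
    linarith
  have ha : ∀ u : Σ i, Fin (m i), 0 < a u.2 := fun u => by
    have h : 0 < a u.2 * x u := by
      rw [hrec]
      refine mul_pos hβ (add_pos_of_pos_of_nonneg hSpos (Finset.sum_nonneg fun q _ => ?_))
      split_ifs
      · exact (hx _).le
      · exact le_rfl
    exact (pos_iff_pos_of_mul_pos h).2 (hx u)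
  -- A largest class contains every position that occurs; the value 0 of `g` beyond it is never
  -- used.
  obtain ⟨i₁, hi₁⟩ := Finite.exists_max m
  let g : ℕ → ℝ := fun p => if h : p < m i₁ then x ⟨i₁, p, h⟩ else 0
  have hxg : ∀ (p : ℕ) (i : Fin k) (hp : p < m i), x ⟨i, p, hp⟩ = g p := by
    intro p
    induction p using Nat.strong_induction_on with
    | _ p ih =>
      have hsumg : ∀ (i : Fin k) (hp : p < m i),
          ∑ q : Fin (m i), (if q < ⟨p, hp⟩ then x ⟨i, q⟩ else 0) = ∑ q ∈ Finset.range p, g q := by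
        intro i hp
        rw [← sum_fin_lt (⟨p, hp⟩ : Fin (m i)) g]
        refine Finset.sum_congr rfl fun q _ => ?_
        split_ifs with hq
        · exact ih q hq i q.2
        · rfl
      intro i hp
      have hp₁ : p < m i₁ := hp.trans_le (hi₁ i)
      have e1 := hrec ⟨i, p, hp⟩
      have e2 := hrec ⟨i₁, p, hp₁⟩
      rw [hsumg i hp] at e1
      rw [hsumg i₁ hp₁, ← e1] at e2
      have := mul_left_cancel₀ (ha ⟨i, p, hp⟩).ne' e2
      simp only [g, dif_pos hp₁]
      exact this.symm
  have hgpos : ∀ p < m i₁, 0 < g p := fun p hp => hxg p i₁ hp ▸ hx _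
  have hapos : ∀ p < m i₁, 0 < a p := fun p hp => ha ⟨i₁, p, hp⟩
  have hgrec : ∀ p < m i₁, a p * g p = (1 - α) * (S + ∑ q ∈ Finset.range p, g q) := by
    intro p hp
    have e := hrec ⟨i₁, p, hp⟩
    rw [← hxg p i₁ hp, e, ← sum_fin_lt (⟨p, hp⟩ : Fin (m i₁)) g]
    simp only [← hxg _ i₁ (Fin.is_lt _), Fin.eta]
  -- In `hgrec` the right side grows with `p`, while the positive factor `a p` does not.
  have hmono : StrictMonoOn g (Set.Iio (m i₁)) := by
    intro p hp q hq hpq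
    have hlt : ∑ j ∈ Finset.range p, g j < ∑ j ∈ Finset.range q, g j := by
      refine Finset.sum_lt_sum_of_subset (Finset.range_mono hpq.le) (Finset.mem_range.2 hpq)
        (by simp) (hgpos p hp) fun j hj _ => (hgpos j ?_).le
      exact (Finset.mem_range.1 hj).trans hq
    have h2 : a p * g p < a q * g q := by
      rw [hgrec p hp, hgrec q hq]
      exact mul_lt_mul_of_pos_left (by linarith) hβ
    have h3 := mul_le_mul_of_nonneg_right (hanti hpq.le) (hgpos p hp).le
    exact lt_of_mul_lt_mul_left (h3.trans_lt h2) (hapos q hq).le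
  obtain ⟨hM, hlt⟩ := sum_sum_range_lt_of_balanced hmono hi₁ hsum hbal' hbal
  have hSg : S = ∑ i, ∑ p ∈ Finset.range (m i), g p := by
    rw [hS, Fintype.sum_sigma]
    refine Finset.sum_congr rfl fun i _ => ?_
    rw [← Fin.sum_univ_eq_sum_range]
    exact Finset.sum_congr rfl fun p _ => hxg p i p.2
  -- The orders agree, so the recurrence for `g` holds in the new join with `S` replaced by a
  -- smaller sum.
  have hz : ∀ u : Σ i, Fin (m' i), (((layeredJoin m').alphaDistMatrix α).mulVec
      fun v => g v.2) u < r * g u.2 := fun u => by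
    have hp : (u.2 : ℕ) < m i₁ := u.2.2.trans_le (hM u.1)
    have hS' : ∑ v : Σ i, Fin (m' i), g v.2 = ∑ i, ∑ p ∈ Finset.range (m' i), g p := by
      rw [Fintype.sum_sigma]
      exact Finset.sum_congr rfl fun i _ => Fin.sum_univ_eq_sum_range g _
    rw [layeredJoin_mulVec hk hm', hS', sum_fin_lt u.2 g, ← hsum]
    have e := hgrec u.2 hp
    have := mul_lt_mul_of_pos_left hlt hβ
    rw [← hSg] at this
    simp only [a] at e
    linarith
  exact Matrix.spectralRadius_lt_of_mulVec_le (alphaDistMatrix_nonneg h0 h1)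
    (fun u v => (layeredJoin_isStronglyConnected hk hm').alphaDistMatrix_pos h1)
    (fun u => hgpos _ (u.2.2.trans_le (hM u.1))) (fun u => (hz u).le) (hz (Classical.arbitrary _))

/-! ### Existence and uniqueness of balanced sizes. -/

theorem eq_or_eq_succ_of_balanced {k n : ℕ} {m : Fin k → ℕ} (hbal : ∀ i j, m i ≤ m j + 1)
    (hsum : ∑ i, m i = n) (i : Fin k) : m i = n / k ∨ m i = n / k + 1 := by
  have : Nonempty (Fin k) := ⟨i⟩
  obtain ⟨i₀, hi₀⟩ := Finite.exists_min m
  have hlow : k * m i₀ ≤ n := by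
    rw [← hsum]
    simpa using Finset.card_nsmul_le_sum Finset.univ m (m i₀) fun j _ => hi₀ j
  have hup : n < k * (m i₀ + 1) := by
    have := Finset.sum_lt_sum (f := m) (g := fun _ => m i₀ + 1) (s := Finset.univ)
      (fun j _ => hbal j i₀) ⟨i₀, Finset.mem_univ _, Nat.lt_succ_self _⟩
    rw [← hsum]
    simpa using this
  have hq : n / k = m i₀ := Nat.div_eq_of_lt_le (by linarith) (by linarith)
  have := hi₀ i
  have := hbal i i₀
  omega

/-- Equal totals force equally many classes of size `n / k + 1`; a bijection between these extends
to all indices. -/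
theorem exists_perm_of_balanced {k : ℕ} {m m' : Fin k → ℕ} (hbal : ∀ i j, m i ≤ m j + 1)
    (hbal' : ∀ i j, m' i ≤ m' j + 1) (hsum : ∑ i, m i = ∑ i, m' i) :
    ∃ σ : Equiv.Perm (Fin k), ∀ i, m i = m' (σ i) := by
  set n := ∑ i, m' i with hn
  have h := eq_or_eq_succ_of_balanced hbal hsum
  have h' := eq_or_eq_succ_of_balanced hbal' hn.symm
  have count : ∀ f : Fin k → ℕ, (∀ i, f i = n / k ∨ f i = n / k + 1) →
      ∑ i, f i = k * (n / k) + Fintype.card {i // f i = n / k + 1} := by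
    intro f hf
    have : ∀ i, f i = n / k + if f i = n / k + 1 then 1 else 0 := fun i => by
      rcases hf i with h | h <;> simp [h]
    rw [Finset.sum_congr rfl fun i _ => this i, Finset.sum_add_distrib, Fintype.card_subtype]
    simp
  have hcard : Fintype.card {i // m i = n / k + 1} = Fintype.card {i // m' i = n / k + 1} := by
    have := count m h
    have := count m' h'
    omega
  let e := Fintype.equivOfCardEq hcard
  refine ⟨e.extendSubtype, fun i => ?_⟩
  by_cases hi : m i = n / k + 1
  · rw [hi, e.extendSubtype_mem i hi]
  · have := e.extendSubtype_not_mem i hi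
    rcases h i with h1 | h1
    · rcases h' (e.extendSubtype i) with h2 | h2
      · rw [h1, h2]
      · exact absurd h2 this
    · exact absurd h1 hi

theorem layeredJoin_isomorphic_of_perm {k : ℕ} {m m' : Fin k → ℕ} (σ : Equiv.Perm (Fin k))
    (h : ∀ i, m i = m' (σ i)) : (layeredJoin m).Isomorphic (layeredJoin m') :=
  ⟨⟨Equiv.sigmaCongr σ fun i => finCongr (h i), by
    rintro ⟨i, p⟩ ⟨j, q⟩
    simp [layeredJoin, Equiv.sigmaCongr]⟩⟩

theorem exists_balanced {n k : ℕ} (hk : 0 < k) (hkn : k ≤ n) :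
    ∃ m : Fin k → ℕ, (∀ i, 0 < m i) ∧ (∀ i j, m i ≤ m j + 1) ∧ ∑ i, m i = n := by
  refine ⟨fun i => n / k + if (i : ℕ) < n % k then 1 else 0, fun i => ?_, fun i j => ?_, ?_⟩
  · have := Nat.div_pos hkn hk
    positivity
  · dsimp only
    split_ifs <;> omega
  · have hc : (Finset.univ.filter fun i : Fin k => (i : ℕ) < n % k).card = n % k := by
      rw [Fin.card_filter_val_lt, min_eq_right (Nat.mod_lt n hk).le]
    rw [Finset.sum_add_distrib, Finset.sum_boole, hc]
    simp [Nat.div_add_mod]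

/-! ### Dichromatic number and the reduction to joins. -/

theorem IsAcyclic.of_map {V W : Type*} {G : Digraph V} {H : Digraph W} (hH : H.IsAcyclic)
    (f : V → W) (hf : ∀ u v, G.Adj u v → H.Adj (f u) (f v)) : G.IsAcyclic :=
  fun v m p => hH (f v) m (p.map hf)

/-- An unused colour could be deleted through `succAbove`, leaving a colouring with fewer colours.
-/
theorem IsAcyclicColoring.surjective {V : Type*} {G : Digraph V} {k : ℕ} {c : V → Fin k}
    (hc : G.IsAcyclicColoring c) (hk : G.dichromaticNumber = k) : Function.Surjective c := by
  intro i
  by_contra! hi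
  obtain ⟨l, rfl⟩ : ∃ l, k = l + 1 := Nat.exists_eq_succ_of_ne_zero i.pos.ne'
  have hex : ∀ v, ∃ j, i.succAbove j = c v := fun v => Fin.exists_succAbove_eq (hi v)
  choose c' hc' using hex
  have : G.dichromaticNumber ≤ l := Nat.sInf_le ⟨c', fun j =>
    (hc (i.succAbove j)).of_map (fun v => ⟨v.1, by
      rw [Set.mem_preimage, ← hc', show c' v.1 = j from v.2]; rfl⟩) fun u v h => h⟩
  omega

theorem dichromaticNumber_le_of_hom {V W : Type*} {G : Digraph V} {H : Digraph W} (f : V → W)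
    (hf : ∀ u v, G.Adj u v → H.Adj (f u) (f v))
    (hne : ∃ (k : ℕ) (c : W → Fin k), H.IsAcyclicColoring c) :
    G.dichromaticNumber ≤ H.dichromaticNumber := by
  obtain ⟨c, hc⟩ := Nat.sInf_mem (s := {k | ∃ c : W → Fin k, H.IsAcyclicColoring c}) hne
  exact Nat.sInf_le ⟨c ∘ f, fun i => (hc i).of_map (fun v => ⟨f v.1, v.2⟩) fun u v => hf _ _⟩

theorem Isomorphic.memC {V W : Type*} [Fintype V] [Fintype W] {G : Digraph V} {H : Digraph W}
    {n k : ℕ} (hk : 0 < k) (h : G.Isomorphic H) (hG : G.MemC n k) : H.MemC n k := by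
  obtain ⟨hn, hs, hsc, hd⟩ := hG
  obtain ⟨e⟩ := h
  have hsymm : ∀ u v, H.Adj u v → G.Adj (e.symm u) (e.symm v) := fun u v => e.symm.map_rel_iff.2
  have hmap : ∀ u v, G.Adj u v → H.Adj (e u) (e v) := fun u v => e.map_rel_iff.2
  -- `sInf ∅ = 0`, so a positive value guarantees that a colouring exists.
  obtain ⟨c, hc⟩ : ∃ c : V → Fin k, G.IsAcyclicColoring c :=
    hd ▸ Nat.sInf_mem (Nat.nonempty_of_pos_sInf (hk.trans_eq hd.symm))
  refine ⟨(Fintype.card_congr e.toEquiv).symm.trans hn, fun v hv => hs _ (hsymm v v hv),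
    fun u v => ?_, le_antisymm ?_ ?_⟩
  · obtain ⟨l, p⟩ := hsc (e.symm u) (e.symm v)
    exact ⟨l, by simpa using p.map hmap⟩
  · exact hd ▸ dichromaticNumber_le_of_hom e.symm hsymm ⟨k, c, hc⟩
  · exact hd ▸ dichromaticNumber_le_of_hom e hmap
      ⟨k, c ∘ e.symm, fun i => (hc i).of_map (fun v => ⟨e.symm v.1, v.2⟩) fun u v => hsymm _ _⟩

theorem layeredJoin_memC {k : ℕ} {m : Fin k → ℕ} (hk : 2 ≤ k) (hm : ∀ i, 0 < m i) :
    (layeredJoin m).MemC (∑ i, m i) k :=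
  ⟨by simp, layeredJoin_isSimple, layeredJoin_isStronglyConnected hk hm,
    layeredJoin_dichromaticNumber hm⟩

/-- Every member of `𝒞ₙᵏ` that is not a join of `k` transitive tournaments has a larger `D_α`
spectral radius than some such join. -/
theorem MemC.isomorphic_or_lt {V : Type*} [Fintype V] [DecidableEq V] {G : Digraph V} {n k : ℕ}
    (hk : 2 ≤ k) (hG : G.MemC n k) : ∃ m : Fin k → ℕ, (∀ i, 0 < m i) ∧ ∑ i, m i = n ∧
      (G.Isomorphic (layeredJoin m) ∨ ∀ α : ℝ, 0 ≤ α → α < 1 →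
        (layeredJoin m).alphaSpectralRadius α < G.alphaSpectralRadius α) := by
  obtain ⟨hn, hs, hsc, hd⟩ := hG
  obtain ⟨c, hc⟩ : ∃ c : V → Fin k, G.IsAcyclicColoring c :=
    hd ▸ Nat.sInf_mem (Nat.nonempty_of_pos_sInf (s := {k | ∃ c : V → Fin k, G.IsAcyclicColoring c})
      (show 0 < G.dichromaticNumber by omega))
  have hm : ∀ i, 0 < (c ⁻¹' {i}).ncard := fun i => by
    obtain ⟨u, rfl⟩ := hc.surjective hd i
    exact (Set.ncard_pos (Set.toFinite _)).2 ⟨u, rfl⟩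
  obtain ⟨E, -, hE⟩ := hc.exists_equiv
  refine ⟨_, hm, ?_, ?_⟩
  · rw [← hn, Fintype.card_congr E, Fintype.card_sigma]
    simp
  set J := layeredJoin fun i => (c ⁻¹' {i}).ncard with hJ
  by_cases hall : ∀ u v, J.Adj (E u) (E v) → G.Adj u v
  · exact .inl ⟨⟨E, fun {u v} => ⟨hall u v, hE u v⟩⟩⟩
  · right
    intro α h0 h1
    push Not at hall
    obtain ⟨a, b, hab, hnab⟩ := hall
    -- The join is pulled back to `V`, so that both matrices have the same index type.
    let G' : Digraph V := ⟨fun u v => J.Adj (E u) (E v)⟩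
    have hiso : G'.Isomorphic J := ⟨⟨E, Iff.rfl⟩⟩
    have hG' : G'.MemC _ k := hiso.symm.memC (by omega) (layeredJoin_memC hk hm)
    have : Nonempty V := ⟨a⟩
    rw [← hiso.alphaSpectralRadius_eq]
    refine hsc.alphaSpectralRadius_lt hG'.2.2.1 hE (a := a) (b := b) ?_ hab hnab h0 h1
    rintro rfl
    exact layeredJoin_isSimple _ hab

end Digraph

/-! ### The extremal theorem. -/

theorem theorem3p3 (n k : ℕ) (hk : 2 ≤ k) (hkn : k ≤ n) :
    ∃ T : Digraph (Fin n), T.MemTStar n k ∧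
      -- `T` is, up to isomorphism, the only balanced member of `𝒯ₙᵏ`
      (∀ (V : Type*) [Fintype V] (G : Digraph V), G.MemTStar n k ↔ G.Isomorphic T) ∧
      T.MemC n k ∧
      ∀ α : ℝ, 0 ≤ α → α < 1 →
        -- `T` is the unique minimiser within `𝒯ₙᵏ`
        (∀ (V : Type*) [Fintype V] [DecidableEq V] (G : Digraph V), G.MemT n k →
          T.alphaSpectralRadius α ≤ G.alphaSpectralRadius α ∧
          (G.alphaSpectralRadius α = T.alphaSpectralRadius α ↔ G.Isomorphic T)) ∧
        -- `T` is the unique minimiser within `𝒞ₙᵏ`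
        (∀ (V : Type*) [Fintype V] [DecidableEq V] (G : Digraph V), G.MemC n k →
          T.alphaSpectralRadius α ≤ G.alphaSpectralRadius α ∧
          (G.alphaSpectralRadius α = T.alphaSpectralRadius α ↔ G.Isomorphic T)) := by
  obtain ⟨m, hm, hbal, hsum⟩ := Digraph.exists_balanced (by omega) hkn
  obtain ⟨E⟩ : Nonempty (Fin n ≃ Σ i, Fin (m i)) :=
    ⟨Fintype.equivOfCardEq (by simp [hsum])⟩
  let T : Digraph (Fin n) := ⟨fun u v => (Digraph.layeredJoin m).Adj (E u) (E v)⟩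
  have hT : T.Isomorphic (Digraph.layeredJoin m) := ⟨⟨E, Iff.rfl⟩⟩
  have hiso : ∀ m' : Fin k → ℕ, (∀ i j, m' i ≤ m' j + 1) → ∑ i, m' i = n →
      (Digraph.layeredJoin m').Isomorphic T := fun m' hbal' hsum' => by
    obtain ⟨σ, hσ⟩ := Digraph.exists_perm_of_balanced hbal' hbal (hsum'.trans hsum.symm)
    exact (Digraph.layeredJoin_isomorphic_of_perm σ hσ).trans hT.symm
  have key : ∀ α : ℝ, 0 ≤ α → α < 1 → ∀ m' : Fin k → ℕ, (∀ i, 0 < m' i) → ∑ i, m' i = n →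
      (Digraph.layeredJoin m').Isomorphic T ∨
        T.alphaSpectralRadius α < (Digraph.layeredJoin m').alphaSpectralRadius α := by
    intro α h0 h1 m' hm' hsum'
    by_cases hbal' : ∀ i j, m' i ≤ m' j + 1
    · exact .inl (hiso m' hbal' hsum')
    · right
      rw [hT.alphaSpectralRadius_eq]
      exact Digraph.layeredJoin_alphaSpectralRadius_lt hk hm' hm
        (hsum'.trans hsum.symm) hbal hbal' h0 h1
  refine ⟨T, Digraph.memTStar_iff.2 ⟨m, hm, hbal, hsum, hT⟩,
    fun V _ G => ⟨fun hG => ?_, fun hG => ?_⟩,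
    hT.symm.memC (by omega) (hsum ▸ Digraph.layeredJoin_memC hk hm), fun α h0 h1 => ⟨?_, ?_⟩⟩
  · obtain ⟨m', -, hbal', hsum', hG'⟩ := Digraph.memTStar_iff.1 hG
    exact hG'.trans (hiso m' hbal' hsum')
  · exact Digraph.memTStar_iff.2 ⟨m, hm, hbal, hsum, hG.trans hT⟩
  · intro V _ _ G hG
    obtain ⟨m', hm', hsum', hG'⟩ := Digraph.memT_iff.1 hG
    rcases key α h0 h1 m' hm' hsum' with h | h
    · have hGT := hG'.trans h
      exact ⟨(hGT.alphaSpectralRadius_eq α).ge, iff_of_true (hGT.alphaSpectralRadius_eq α) hGT⟩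
    · rw [← hG'.alphaSpectralRadius_eq] at h
      exact ⟨h.le, iff_of_false h.ne' fun hGT => h.ne' (hGT.alphaSpectralRadius_eq α)⟩
  · intro V _ _ G hG
    obtain ⟨m', hm', hsum', hG'⟩ := hG.isomorphic_or_lt hk
    have hle : T.alphaSpectralRadius α ≤ (Digraph.layeredJoin m').alphaSpectralRadius α :=
      (key α h0 h1 m' hm' hsum').elim (fun h => (h.alphaSpectralRadius_eq α).ge) le_of_lt
    have : G.Isomorphic T ∨ T.alphaSpectralRadius α < G.alphaSpectralRadius α := by
      rcases hG' with h | h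
      · rw [h.alphaSpectralRadius_eq]
        exact (key α h0 h1 m' hm' hsum').imp_left h.trans
      · exact .inr (hle.trans_lt (h α h0 h1))
    rcases this with h | h
    · exact ⟨(h.alphaSpectralRadius_eq α).ge, iff_of_true (h.alphaSpectralRadius_eq α) h⟩
    · exact ⟨h.le, iff_of_false h.ne' fun hGT => h.ne' (hGT.alphaSpectralRadius_eq α)⟩
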